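/- **Definitions.** Let $\mathbb{Q}_{p\to\infty}$ be the commutative $\mathbb{Q}$-algebra $$\mathbb{Q}_{p\to\infty}=\frac{\{(a_p)\in\prod_p\mathbb{Q}_p : v_p(a_p)\text{ bounded below}\}}{\{(a_p)\in\prod_p\mathbb{Q}_p : v_p(a_p)\to\infty\text{ as }p\to\infty\}},$$ where $p$ runs over the primes, with the topology in which the subgroups $\mathrm{Fil}^n=\{(a_p): a_p\in p^n\mathbb{Z}_p\text{ for all but finitely many }p\}$, $n\in\mathbb{Z}$, form a neighbourhood basis of $0$. A composition is a finite (possibly empty) list $\mathbf{s}=(s_1,\dots,s_r)$ of positive integers, with weight $|\mathbf{s}|=s_1+\cdots+s_r$; put $$H_N(\mathbf{s})=\sum_{N\ge n_1>\cdots>n_r\ge 1}\frac{1}{n_1^{s_1}\cdots n_r^{s_r}}.$$ The MHS algebra is the set of elements of $\mathbb{Q}_{p\to\infty}$ of the form $\sum_{i=1}^\infty \left(c_i\,p^{b_i}H_{p-1}(\mathbf{s}_i)\right)$ (a convergent series in $\mathbb{Q}_{p\to\infty}$), where $c_i\in\mathbb{Q}$, the integers $b_i$ tend to infinity, and the $\mathbf{s}_i$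 are compositions, all independent of $p$. The weighted MHS algebra is the set of elements of the MHS algebra for which the $c_i,b_i,\mathbf{s}_i$ can be chosen with $b_i=|\mathbf{s}_i|$ for all $i$. **Theorem.** For every integer $k\ge 2$, the quantities $$p^k\sum_{n=1}^{(p-1)/2}\frac{1}{n^k}\qquad\text{and}\qquad p^k\sum_{n=1}^{p-1}\frac{(-1)^n}{n^k}$$ define elements of $\mathbb{Q}_{p\to\infty}$ which lie in the weighted MHS algebra. (For $p=2$ the first sum is read as empty; a single prime does not affect the element of $\mathbb{Q}_{p\to\infty}$.) -/

import Mathlib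

open Filter

namespace MHS

instance factPrime (p : Nat.Primes) : Fact (p : ℕ).Prime := ⟨p.2⟩

/-! ### The ring of prime-indexed sequences -/

/-- Families `(a_p) ∈ ∏_p ℚ_p` indexed by the primes. -/
abbrev PadicFamily : Type := ∀ p : Nat.Primes, ℚ_[(p : ℕ)]

/-- `ValGE n p x` says `x ∈ p ^ n ℤ_p`, i.e. `v_p(x) ≥ n`, with the convention `v_p(0) = ∞`. -/
def ValGE (n : ℤ) (p : Nat.Primes) (x : ℚ_[(p : ℕ)]) : Prop :=
  ‖x‖ ≤ ((p : ℕ) : ℝ) ^ (-n)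

theorem one_le_prime (p : Nat.Primes) : (1 : ℝ) ≤ ((p : ℕ) : ℝ) := by
  exact_mod_cast p.2.one_lt.le

theorem prime_pos (p : Nat.Primes) : (0 : ℝ) < ((p : ℕ) : ℝ) :=
  lt_of_lt_of_le one_pos (one_le_prime p)

theorem ValGE.mono {m n : ℤ} (h : m ≤ n) {p : Nat.Primes} {x : ℚ_[(p : ℕ)]}
    (hx : ValGE n p x) : ValGE m p x :=
  le_trans hx (zpow_le_zpow_right₀ (one_le_prime p) (by omega))

theorem ValGE.zero (n : ℤ) (p : Nat.Primes) : ValGE n p 0 := by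
  unfold ValGE
  rw [norm_zero]
  exact (zpow_pos (prime_pos p) _).le

theorem ValGE.add {n : ℤ} {p : Nat.Primes} {x y : ℚ_[(p : ℕ)]}
    (hx : ValGE n p x) (hy : ValGE n p y) : ValGE n p (x + y) :=
  (Padic.nonarchimedean x y).trans (max_le hx hy)

theorem ValGE.neg {n : ℤ} {p : Nat.Primes} {x : ℚ_[(p : ℕ)]}
    (hx : ValGE n p x) : ValGE n p (-x) := by
  unfold ValGE at *
  rwa [norm_neg]

theorem ValGE.mul {m n : ℤ} {p : Nat.Primes} {x y : ℚ_[(p : ℕ)]}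
    (hx : ValGE m p x) (hy : ValGE n p y) : ValGE (m + n) p (x * y) := by
  unfold ValGE at *
  rw [norm_mul, neg_add, zpow_add₀ (prime_pos p).ne']
  exact mul_le_mul hx hy (norm_nonneg _) (zpow_pos (prime_pos p) _).le

theorem ValGE.ratCast (c : ℚ) (p : Nat.Primes) : ValGE (-(c.den : ℤ)) p (c : ℚ_[(p : ℕ)]) := by
  unfold ValGE
  rcases eq_or_ne c 0 with rfl | hc
  · simp
  have hc' : (c : ℚ_[(p : ℕ)]) ≠ 0 := by exact_mod_cast hc
  rw [Padic.norm_eq_zpow_neg_valuation hc', Padic.valuation_ratCast]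
  refine zpow_le_zpow_right₀ (one_le_prime p) ?_
  have h1 : padicValNat (p : ℕ) c.den ≤ c.den := by
    have h2 := Nat.le_of_dvd c.den_pos (pow_padicValNat_dvd (p := (p : ℕ)) (n := c.den))
    exact ((Nat.lt_pow_self p.2.one_lt).le).trans h2
  unfold padicValRat
  omega

/-- The families `(a_p)` with `v_p(a_p)` bounded below. -/
def boundedBelow : Subalgebra ℚ PadicFamily where
  carrier := {a | ∃ m : ℤ, ∀ p, ValGE m p (a p)}
  mul_mem' := by
    rintro a b ⟨m, hm⟩ ⟨n, hn⟩
    exact ⟨m + n, fun p => (hm p).mul (hn p)⟩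
  add_mem' := by
    rintro a b ⟨m, hm⟩ ⟨n, hn⟩
    exact ⟨min m n, fun p =>
      ((hm p).mono (min_le_left _ _)).add ((hn p).mono (min_le_right _ _))⟩
  algebraMap_mem' := by
    intro c
    exact ⟨-(c.den : ℤ), fun p => by simpa using ValGE.ratCast c p⟩

/-- The families `(a_p)` with `v_p(a_p) → ∞` as `p → ∞`. -/
def vanishing : Ideal boundedBelow where
  carrier := {a | ∀ n : ℤ, ∀ᶠ p in cofinite, ValGE n p (a.1 p)}
  zero_mem' := fun n => Eventually.of_forall fun p => ValGE.zero n p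
  add_mem' := by
    intro a b ha hb n
    filter_upwards [ha n, hb n] with p h1 h2 using h1.add h2
  smul_mem' := by
    rintro ⟨c, m, hm⟩ a ha n
    filter_upwards [ha (n - m)] with p hp
    simpa using (hm p).mul hp

/-- The commutative `ℚ`-algebra `ℚ_{p → ∞}`. -/
def QInf : Type := boundedBelow ⧸ vanishing

noncomputable instance : CommRing QInf := inferInstanceAs (CommRing (boundedBelow ⧸ vanishing))

noncomputable instance : Algebra ℚ QInf := inferInstanceAs (Algebra ℚ (boundedBelow ⧸ vanishing))

/-- The quotient map: the class `(a_p) ∈ ℚ_{p → ∞}` of a family with `v_p(a_p)` bounded below. -/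
noncomputable def QInf.mk : boundedBelow →+* QInf := Ideal.Quotient.mk vanishing

/-- The families with `a_p ∈ p ^ n ℤ_p` for all but finitely many `p`. -/
def filFamily (n : ℤ) : AddSubgroup boundedBelow where
  carrier := {a | ∀ᶠ p in cofinite, ValGE n p (a.1 p)}
  zero_mem' := by
    change ∀ᶠ p in cofinite, ValGE n p 0
    exact Eventually.of_forall fun p => ValGE.zero n p
  add_mem' := by
    intro a b (ha : ∀ᶠ p in cofinite, ValGE n p (a.1 p)) (hb : ∀ᶠ p in cofinite, ValGE n p (b.1 p))
    change ∀ᶠ p in cofinite, ValGE n p (a.1 p + b.1 p)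
    filter_upwards [ha, hb] with p h1 h2 using h1.add h2
  neg_mem' := by
    intro a (ha : ∀ᶠ p in cofinite, ValGE n p (a.1 p))
    change ∀ᶠ p in cofinite, ValGE n p (-a.1 p)
    filter_upwards [ha] with p h1 using h1.neg

/-- The filtration `Fil^n` of `ℚ_{p → ∞}`. -/
noncomputable def Fil (n : ℤ) : AddSubgroup QInf := (filFamily n).map QInf.mk.toAddMonoidHom

theorem Fil_anti {m n : ℤ} (h : m ≤ n) : Fil n ≤ Fil m := by
  refine AddSubgroup.map_mono ?_
  intro a (ha : ∀ᶠ p in cofinite, ValGE n p (a.1 p))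
  change ∀ᶠ p in cofinite, ValGE m p (a.1 p)
  filter_upwards [ha] with p hp using hp.mono h

theorem Fil_basis : RingSubgroupsBasis Fil := by
  refine RingSubgroupsBasis.of_comm Fil ?_ ?_ ?_
  · intro i j
    exact ⟨max i j, le_inf (Fil_anti (le_max_left _ _)) (Fil_anti (le_max_right _ _))⟩
  · intro i
    refine ⟨max i 0, ?_⟩
    rintro _ ⟨_, ⟨a, ha, rfl⟩, _, ⟨b, hb, rfl⟩, rfl⟩
    refine ⟨a * b, ?_, map_mul QInf.mk a b⟩
    replace ha : ∀ᶠ p in cofinite, ValGE (max i 0) p (a.1 p) := ha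
    replace hb : ∀ᶠ p in cofinite, ValGE (max i 0) p (b.1 p) := hb
    change ∀ᶠ p in cofinite, ValGE i p (a.1 p * b.1 p)
    filter_upwards [ha, hb] with p h1 h2 using (h1.mul h2).mono (by omega)
  · intro x i
    obtain ⟨⟨c, m, hm⟩, rfl⟩ := Ideal.Quotient.mk_surjective x
    refine ⟨i - m, ?_⟩
    rintro _ ⟨a, ha, rfl⟩
    refine ⟨⟨c, m, hm⟩ * a, ?_, map_mul QInf.mk _ a⟩
    replace ha : ∀ᶠ p in cofinite, ValGE (i - m) p (a.1 p) := ha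
    change ∀ᶠ p in cofinite, ValGE i p (c p * a.1 p)
    filter_upwards [ha] with p h1
    simpa using (hm p).mul h1

/-- The ring topology on `ℚ_{p → ∞}` for which the `Fil^n` form a neighbourhood basis of `0`. -/
noncomputable instance : TopologicalSpace QInf := Fil_basis.topology

/-! ### Multiple harmonic sums -/

/-- The weight of a composition, i.e. of a finite list of positive integers (possibly empty). -/
def weight (s : List ℕ+) : ℕ := (s.map fun m => (m : ℕ)).sum

open Classical in
/-- The multiple harmonic sum
`H_N(s_1, …, s_k) = ∑_{N ≥ n_1 > ⋯ > n_k ≥ 1} 1 / (n_1 ^ s_1 ⋯ n_k ^ s_k)`. -/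
noncomputable def harmonicSum (N : ℕ) (s : List ℕ+) : ℚ :=
  ∑ n ∈ (Fintype.piFinset fun _ : Fin s.length => Finset.Icc 1 N) with StrictAnti n,
    ∏ i, 1 / (n i : ℚ) ^ (s.get i : ℕ)

/-- The family `p ^ b H_{p-1}(s)`. -/
noncomputable def mhsFamily (b : ℤ) (s : List ℕ+) : PadicFamily := fun p =>
  (((p : ℕ) : ℚ) ^ b * harmonicSum ((p : ℕ) - 1) s : ℚ)

theorem mhsFamily_valGE (b : ℤ) (s : List ℕ+) (p : Nat.Primes) :
    ValGE b p (mhsFamily b s p) := by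
  have h1 : ‖((harmonicSum ((p : ℕ) - 1) s : ℚ) : ℚ_[(p : ℕ)])‖ ≤ 1 := by
    unfold harmonicSum
    push_cast
    refine IsUltrametricDist.norm_sum_le_of_forall_le_of_nonneg zero_le_one fun n hn => ?_
    rw [Finset.mem_filter, Fintype.mem_piFinset] at hn
    rw [norm_prod]
    refine (Finset.prod_eq_one fun i _ => ?_).le
    have hi := Finset.mem_Icc.1 (hn.1 i)
    have h2 : ‖((n i : ℕ) : ℚ_[(p : ℕ)])‖ = 1 := by
      rw [Padic.norm_natCast_eq_one_iff, p.2.coprime_iff_not_dvd]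
      intro hd
      have := Nat.le_of_dvd (by omega) hd
      have := p.2.pos
      omega
    simp [h2]
  unfold ValGE mhsFamily
  push_cast
  rw [norm_mul, Padic.norm_p_zpow]
  exact mul_le_of_le_one_right (zpow_pos (prime_pos p) _).le h1

/-- The element `(p ^ b H_{p-1}(s))` of `ℚ_{p → ∞}`. -/
noncomputable def mhsElement (b : ℤ) (s : List ℕ+) : QInf :=
  QInf.mk ⟨mhsFamily b s, b, mhsFamily_valGE b s⟩

/-! ### The MHS algebra and the weighted MHS algebra -/

/-- `x = ∑ i, c_i p ^ {b_i} H_{p-1}(s_i)` as a convergent series in `ℚ_{p → ∞}`, with rational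
numbers `c_i`, integers `b_i → ∞` and compositions `s_i`, all independent of `p`. -/
def IsMHSExpansion (c : ℕ → ℚ) (b : ℕ → ℤ) (s : ℕ → List ℕ+) (x : QInf) : Prop :=
  Tendsto b atTop atTop ∧ HasSum (fun i => c i • mhsElement (b i) (s i)) x

/-- The MHS algebra. -/
def mhsAlgebra : Set QInf := {x | ∃ c b s, IsMHSExpansion c b s x}

/-- The weighted MHS algebra: the elements of the MHS algebra having an expansion in which
`b_i = |s_i|` for all `i`. -/
def weightedMHSAlgebra : Set QInf :=
  {x | x ∈ mhsAlgebra ∧ ∃ c b s, IsMHSExpansion c b s x ∧ ∀ i, b i = (weight (s i) : ℤ)}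

/-- The sequence of rational numbers `a_p` defines an element of `ℚ_{p → ∞}`, and this element
lies in the weighted MHS algebra. -/
def InWeightedMHSAlgebra (a : Nat.Primes → ℚ) : Prop :=
  ∃ h : (fun p : Nat.Primes => (a p : ℚ_[(p : ℕ)])) ∈ boundedBelow,
    QInf.mk ⟨fun p : Nat.Primes => (a p : ℚ_[(p : ℕ)]), h⟩ ∈ weightedMHSAlgebra

end MHS

/-! ### Truncated binomial series -/

namespace MHS

/-! Write P_k = p^k H_{p-1}(k) and let U_k be p^k times the sum of 1/n^k over p/2 < n < p. For odd
p, doubling modulo p permutes the nonzero residues: n < p/2 goes to 2n, and n > p/2 to 2n - p. Hence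
(2^k - 1) P_k is p^k times the sum over p/2 < n < p of 2^k/(2n-p)^k - 1/n^k. Expanding in powers of
p/(2n) cancels the leading term and gives (2^k - 1) P_k = ∑_{j≥1} C(k-1+j, j) 2^(-j) U_{k+j}
(`doubling_relation`). The coefficient k/2 of U_{k+1} is nonzero, so this triangular system can be
inverted: each U_k with k ≥ 2 is an infinite combination of P_{k-1}, P_k, ... with rational
coefficients independent of p (`HasUpperExpansion.hasPowerSumExpansion`). Both sums of the theorem
are combinations of P_k and U_k, and P_i carries exactly the power of p that its weight requires. -/

open Finset in
theorem sum_choose_mul_pow_mul_one_sub {R : Type*} [CommRing R] (t : R) (m J : ℕ) :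
    (∑ j ∈ range J, ((m + 1 + j).choose (m + 1) : R) * t ^ j) * (1 - t) =
      (∑ j ∈ range J, ((m + j).choose m : R) * t ^ j) - ((m + J).choose (m + 1) : R) * t ^ J := by
  induction J with
  | zero => simp
  | succ J ih =>
    rw [sum_range_succ, sum_range_succ, add_mul, ih]
    have h : ((m + 1 + J).choose (m + 1) : R) = (m + J).choose m + (m + J).choose (m + 1) := by
      rw [show m + 1 + J = (m + J) + 1 by ring, Nat.choose_succ_succ]
      push_cast
      ring
    rw [show m + (J + 1) = m + 1 + J by ring, h]
    ring

theorem norm_one_sub_eq_one {K : Type*} [NormedField K] [IsUltrametricDist K] {t : K}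
    (ht : ‖t‖ < 1) : ‖1 - t‖ = 1 := by
  have h := IsUltrametricDist.norm_add_eq_max_of_norm_ne_norm (x := (1 : K)) (y := -t)
    (by rw [norm_one, norm_neg]; exact ht.ne')
  rw [norm_one, norm_neg, max_eq_left ht.le] at h
  rwa [sub_eq_add_neg]

open Finset in
/-- Truncation error of the binomial series of `(1 - t)⁻¹ ^ (m + 1)` over a nonarchimedean field. -/
theorem norm_inv_one_sub_pow_sub_sum_le {K : Type*} [NormedField K] [IsUltrametricDist K] {t : K}
    (ht : ‖t‖ < 1) (m J : ℕ) :
    ‖(1 - t)⁻¹ ^ (m + 1) - ∑ j ∈ range J, ((m + j).choose m : K) * t ^ j‖ ≤ ‖t‖ ^ J := by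
  have h1 := norm_one_sub_eq_one ht
  have h0 : (1 - t) ≠ 0 := by
    rw [← norm_ne_zero_iff, h1]
    exact one_ne_zero
  induction m with
  | zero =>
    have h : (1 - t)⁻¹ ^ (0 + 1) - ∑ j ∈ range J, ((0 + j).choose 0 : K) * t ^ j =
        (1 - t)⁻¹ * t ^ J := by
      have hg := geom_sum_mul_neg t J
      simp only [Nat.choose_zero_right, Nat.cast_one, one_mul, zero_add, pow_one]
      field_simp
      rw [mul_comm, hg]
      ring
    rw [h, norm_mul, norm_inv, h1, norm_pow]
    simp
  | succ m ih =>
    -- Pascal's rule makes the new error (1 - t)⁻¹ times the old error plus a boundary term; both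
    -- are at most ‖t‖ ^ J, and 1 - t has norm 1.
    have h : (1 - t)⁻¹ ^ (m + 1 + 1) - ∑ j ∈ range J, ((m + 1 + j).choose (m + 1) : K) * t ^ j =
        (1 - t)⁻¹ * (((1 - t)⁻¹ ^ (m + 1) - ∑ j ∈ range J, ((m + j).choose m : K) * t ^ j) +
          ((m + J).choose (m + 1) : K) * t ^ J) := by
      have hg := sum_choose_mul_pow_mul_one_sub t m J
      have hi : (1 - t) * (1 - t)⁻¹ = 1 := mul_inv_cancel₀ h0
      rw [eq_inv_mul_iff_mul_eq₀ h0, mul_sub, mul_comm (1 - t) (∑ j ∈ range J, _), hg, pow_succ']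
      linear_combination (1 - t)⁻¹ ^ (m + 1) * hi
    rw [h, norm_mul, norm_inv, h1, inv_one, one_mul]
    refine (IsUltrametricDist.norm_add_le_max _ _).trans (max_le ih ?_)
    rw [norm_mul, norm_pow]
    exact mul_le_of_le_one_left (by positivity) (IsUltrametricDist.norm_natCast_le_one K _)

/-! ### Integrality of power sums over residues prime to p -/

theorem norm_natCast_eq_one {p : Nat.Primes} {n : ℕ} (h0 : 0 < n) (hn : n < p) :
    ‖(n : ℚ_[(p : ℕ)])‖ = 1 := by
  rw [Padic.norm_natCast_eq_one_iff, p.2.coprime_iff_not_dvd]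
  exact Nat.not_dvd_of_pos_of_lt h0 hn

/-- A signed power sum over residues prime to `p`, multiplied by `p ^ k`. -/
theorem valGE_pow_mul_sum (p : Nat.Primes) (k : ℕ) (S : Finset ℕ) (g : ℕ → ℤ)
    (hS : ∀ n ∈ S, 0 < n ∧ n < p) :
    ValGE k p (((((p : ℕ) : ℚ) ^ k * ∑ n ∈ S, (g n : ℚ) / (n : ℚ) ^ k : ℚ)) : ℚ_[(p : ℕ)]) := by
  unfold ValGE
  push_cast
  rw [norm_mul, norm_pow, Padic.norm_p, inv_pow, zpow_neg, zpow_natCast]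
  refine mul_le_of_le_one_right (by positivity) ?_
  refine IsUltrametricDist.norm_sum_le_of_forall_le_of_nonneg zero_le_one fun n hn => ?_
  rw [norm_div, norm_pow, norm_natCast_eq_one (hS n hn).1 (hS n hn).2, one_pow, div_one]
  exact Padic.norm_int_le_one _

theorem harmonicSum_singleton (N : ℕ) (a : ℕ+) :
    harmonicSum N [a] = ∑ n ∈ Finset.Icc 1 N, 1 / (n : ℚ) ^ (a : ℕ) := by
  classical
  unfold harmonicSum
  symm
  refine Finset.sum_bij (fun n _ => fun _ => n) ?_ ?_ ?_ ?_
  · intro n hn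
    rw [Finset.mem_filter, Fintype.mem_piFinset]
    exact ⟨fun _ => hn, fun i j hij => absurd hij (by
      rw [Subsingleton.elim (α := Fin 1) i j]; exact lt_irrefl _)⟩
  · intro n _ n' _ h
    exact congrFun h (0 : Fin 1)
  · intro f hf
    rw [Finset.mem_filter, Fintype.mem_piFinset] at hf
    exact ⟨f (0 : Fin 1), hf.1 (0 : Fin 1), funext fun i => by
      rw [Subsingleton.elim (α := Fin 1) i 0]⟩
  · intro n _
    exact (Fin.prod_univ_one (fun i : Fin 1 => 1 / (n : ℚ) ^ (([a] : List ℕ+).get i : ℕ))).symm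

/-! ### The filtration -/

theorem mk_smul (c : ℚ) (a : boundedBelow) : QInf.mk (c • a) = c • QInf.mk a := rfl

theorem mk_mem_Fil {n : ℤ} {a : boundedBelow} (h : ∀ᶠ p in cofinite, ValGE n p (a.1 p)) :
    QInf.mk a ∈ Fil n :=
  ⟨a, h, rfl⟩

theorem mk_eq_mk {a b : boundedBelow} (h : ∀ᶠ p in cofinite, a.1 p = b.1 p) :
    QInf.mk a = QInf.mk b := by
  refine Ideal.Quotient.eq.2 fun n => ?_
  filter_upwards [h] with p hp
  change ValGE n p (a.1 p - b.1 p)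
  rw [hp, sub_self]
  exact ValGE.zero n p

theorem eventually_gt (N : ℕ) : ∀ᶠ p : Nat.Primes in cofinite, N < (p : ℕ) := by
  have h : {n : ℕ | N < n}ᶜ.Finite := (Set.finite_le_nat N).subset fun n hn => by
    simpa using hn
  exact Nat.Primes.coe_nat_injective.tendsto_cofinite h

/-- A fixed rational is p-integral for every p exceeding its denominator, and finitely many primes
do not matter. -/
theorem smul_mem_Fil {n : ℤ} (c : ℚ) {x : QInf} (hx : x ∈ Fil n) : c • x ∈ Fil n := by
  obtain ⟨a, ha, rfl⟩ := hx
  refine mk_mem_Fil (a := c • a) ?_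
  replace ha : ∀ᶠ p in cofinite, ValGE n p (a.1 p) := ha
  filter_upwards [ha, eventually_gt c.den] with p hp hc
  change ValGE n p (c • a.1 p)
  unfold ValGE at *
  rw [Rat.smul_def, norm_mul]
  refine (mul_le_of_le_one_left (norm_nonneg _) ?_).trans hp
  refine Padic.norm_rat_le_one fun hd => ?_
  exact absurd (Nat.le_of_dvd c.den_pos hd) (by omega)

/-- In a nonarchimedean filtration, the terms beyond an initial segment contribute an element of Fil
n however they are selected, so convergence along initial segments is already unconditional. -/
theorem hasSum_of_forall_mem_Fil {f : ℕ → QInf} {x : QInf} (hf : ∀ i : ℕ, f i ∈ Fil (i + 1))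
    (h : ∀ J : ℕ, x - ∑ i ∈ Finset.range J, f i ∈ Fil (J + 1)) : HasSum f x := by
  refine (Fil_basis.hasBasis_nhds x).tendsto_right_iff.2 fun n _ => ?_
  filter_upwards [eventually_ge_atTop (Finset.range n.toNat)] with s hs
  change ∑ i ∈ s, f i - x ∈ Fil n
  have h1 : ∑ i ∈ s \ Finset.range n.toNat, f i ∈ Fil n := by
    refine sum_mem fun i hi => Fil_anti ?_ (hf i)
    rw [Finset.mem_sdiff, Finset.mem_range] at hi
    omega
  have h2 := Fil_anti (m := n) (by omega) (h n.toNat)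
  rw [← Finset.sum_sdiff hs, add_sub_assoc, ← neg_sub x]
  exact add_mem h1 (neg_mem h2)

/-! ### Power sums -/

/-- The element `p ^ (m + 1) H_{p-1}(m + 1)`. -/
noncomputable def powerSum (m : ℕ) : QInf := mhsElement ((m + 1 : ℕ) : ℤ) [m.succPNat]

theorem half_bounds (p : Nat.Primes) (n : ℕ) (hn : n ∈ Finset.Icc 1 (((p : ℕ) - 1) / 2)) :
    0 < n ∧ n < p := by
  have := p.2.pos
  rw [Finset.mem_Icc] at hn
  omega

theorem full_bounds (p : Nat.Primes) (n : ℕ) (hn : n ∈ Finset.Icc 1 ((p : ℕ) - 1)) :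
    0 < n ∧ n < p := by
  have := p.2.pos
  rw [Finset.mem_Icc] at hn
  omega

theorem upper_bounds (p : Nat.Primes) (n : ℕ)
    (hn : n ∈ Finset.Ioc (((p : ℕ) - 1) / 2) ((p : ℕ) - 1)) : 0 < n ∧ n < p := by
  have := p.2.pos
  rw [Finset.mem_Ioc] at hn
  omega

/-- The family `p ^ k ∑_{n ∈ S_p} g(n) / n ^ k`, for sets `S_p` of positive integers below `p`. -/
noncomputable def signedFamily (S : Nat.Primes → Finset ℕ) (g : ℕ → ℤ)
    (hS : ∀ p, ∀ n ∈ S p, 0 < n ∧ n < p) (k : ℕ) : boundedBelow :=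
  ⟨fun p => ((((p : ℕ) : ℚ) ^ k * ∑ n ∈ S p, (g n : ℚ) / (n : ℚ) ^ k : ℚ) : ℚ_[(p : ℕ)]),
    k, fun p => valGE_pow_mul_sum p k (S p) g (hS p)⟩

/-- The family `p ^ k H_{p-1}(k)`. -/
noncomputable def fullFamily (k : ℕ) : boundedBelow :=
  signedFamily (fun p => Finset.Icc 1 ((p : ℕ) - 1)) 1 full_bounds k

/-- The family `p ^ k ∑_{p / 2 < n < p} 1 / n ^ k`. -/
noncomputable def upperFamily (k : ℕ) : boundedBelow :=
  signedFamily (fun p => Finset.Ioc (((p : ℕ) - 1) / 2) ((p : ℕ) - 1)) 1 upper_bounds k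

/-- The element `p ^ (m + 1) ∑_{p / 2 < n < p} 1 / n ^ (m + 1)`. -/
noncomputable def upperSum (m : ℕ) : QInf := QInf.mk (upperFamily (m + 1))

theorem powerSum_eq (m : ℕ) : powerSum m = QInf.mk (fullFamily (m + 1)) := by
  refine mk_eq_mk (Eventually.of_forall fun p => ?_)
  change mhsFamily _ _ p = (((_ : ℚ)) : ℚ_[(p : ℕ)])
  unfold mhsFamily
  rw [harmonicSum_singleton, zpow_natCast]
  simp

theorem powerSum_mem_Fil (m : ℕ) : powerSum m ∈ Fil (m + 1) := by
  rw [powerSum_eq]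
  refine mk_mem_Fil (Eventually.of_forall fun p => ?_)
  rw [← Nat.cast_succ]
  exact valGE_pow_mul_sum p (m + 1) _ 1 (full_bounds p)

theorem upperSum_mem_Fil (m : ℕ) : upperSum m ∈ Fil (m + 1) := by
  refine mk_mem_Fil (Eventually.of_forall fun p => ?_)
  rw [← Nat.cast_succ]
  exact valGE_pow_mul_sum p (m + 1) _ 1 (upper_bounds p)

/-- Splitting by parity; with p = 2q + 1 this is the bijection n ↦ 2n mod p. -/
theorem sum_Icc_one_two_mul {M : Type*} [AddCommMonoid M] (f : ℕ → M) (q : ℕ) :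
    ∑ n ∈ Finset.Icc 1 (2 * q), f n =
      ∑ n ∈ Finset.Icc 1 q, f (2 * n) + ∑ n ∈ Finset.Ioc q (2 * q), f (2 * n - (2 * q + 1)) := by
  have h1 : ∑ n ∈ Finset.Icc 1 (2 * q), f n =
      ∑ i ∈ Finset.range q, f (2 * (i + 1)) + ∑ i ∈ Finset.range q, f (2 * i + 1) := by
    induction q with
    | zero => simp
    | succ q ih =>
      rw [show 2 * (q + 1) = 2 * q + 1 + 1 by ring, Finset.sum_Icc_succ_top (by omega),
        Finset.sum_Icc_succ_top (by omega), ih, Finset.sum_range_succ, Finset.sum_range_succ,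
        show 2 * (q + 1) = 2 * q + 1 + 1 by ring]
      abel
  rw [h1]
  congr 1
  · rw [Finset.range_eq_Ico, Finset.sum_Ico_add' (fun n => f (2 * n)) 0 q 1]
    rfl
  · rw [Finset.range_eq_Ico,
      show ∑ i ∈ Finset.Ico 0 q, f (2 * i + 1) =
        ∑ i ∈ Finset.Ico 0 q, (fun n => f (2 * n - (2 * q + 1))) (i + (q + 1)) from
        Finset.sum_congr rfl fun i _ => by congr 1; omega,
      Finset.sum_Ico_add' (fun n => f (2 * n - (2 * q + 1))) 0 q (q + 1)]
    refine Finset.sum_congr ?_ fun _ _ => rfl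
    ext n
    simp only [Finset.mem_Ico, Finset.mem_Ioc]
    omega

theorem sum_Icc_one_eq_add_sum_Ioc {M : Type*} [AddCommMonoid M] (f : ℕ → M) {q N : ℕ}
    (h : q ≤ N) :
    ∑ n ∈ Finset.Icc 1 N, f n = ∑ n ∈ Finset.Icc 1 q, f n + ∑ n ∈ Finset.Ioc q N, f n := by
  have := Finset.sum_Ioc_consecutive f (Nat.zero_le q) h
  exact this.symm

/-- Comparing the power sum over `n` with the one over `2 n mod p`. -/
theorem two_pow_sub_one_mul_sum {K : Type*} [Field K] [CharZero K] (k q : ℕ) :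
    ((2 : K) ^ k - 1) * ∑ n ∈ Finset.Icc 1 (2 * q), 1 / (n : K) ^ k =
      ∑ n ∈ Finset.Ioc q (2 * q),
        (2 ^ k / (2 * (n : K) - (2 * (q : K) + 1)) ^ k - 1 / (n : K) ^ k) := by
  rw [sub_mul, one_mul, Finset.sum_sub_distrib]
  -- Only the copy multiplied by 2^k is reindexed by doubling. The other is cut at q, and the two
  -- sums over n ≤ q then cancel.
  conv_lhs =>
    enter [1]
    rw [sum_Icc_one_two_mul]
  rw [sum_Icc_one_eq_add_sum_Ioc _ (show q ≤ 2 * q by omega), mul_add, Finset.mul_sum,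
    Finset.mul_sum]
  have h1 : ∑ n ∈ Finset.Icc 1 q, (2 : K) ^ k * (1 / ((2 * n : ℕ) : K) ^ k) =
      ∑ n ∈ Finset.Icc 1 q, 1 / (n : K) ^ k :=
    Finset.sum_congr rfl fun n hn => by
      have : (n : K) ≠ 0 := by
        rw [Finset.mem_Icc] at hn
        exact_mod_cast (by omega : n ≠ 0)
      push_cast
      rw [mul_pow]
      field_simp
  have h2 : ∑ n ∈ Finset.Ioc q (2 * q), (2 : K) ^ k * (1 / ((2 * n - (2 * q + 1) : ℕ) : K) ^ k) =
      ∑ n ∈ Finset.Ioc q (2 * q), 2 ^ k / (2 * (n : K) - (2 * (q : K) + 1)) ^ k :=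
    Finset.sum_congr rfl fun n hn => by
      rw [Finset.mem_Ioc] at hn
      rw [Nat.cast_sub (by omega)]
      push_cast
      rw [mul_one_div]
  rw [h1, h2]
  ring

/-- The coefficients expressing power sums over `0 < n < p` through those over `p / 2 < n < p`. -/
noncomputable def doublingCoeff (m i : ℕ) : ℚ := ((m + (i + 1)).choose m : ℚ) / 2 ^ (i + 1)

theorem valGE_doubling_term {p : Nat.Primes} (hp : 2 < (p : ℕ)) (m J n : ℕ) (h0 : 0 < n)
    (hn : n < p) :
    ValGE (m + 2 + J) p (((p : ℕ) : ℚ_[(p : ℕ)]) ^ (m + 1) *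
        (2 ^ (m + 1) / (2 * (n : ℚ_[(p : ℕ)]) - (p : ℕ)) ^ (m + 1) - 1 / (n : ℚ_[(p : ℕ)]) ^ (m + 1)) -
      ∑ i ∈ Finset.range J, (doublingCoeff m i : ℚ_[(p : ℕ)]) *
        (((p : ℕ) : ℚ_[(p : ℕ)]) ^ (m + 1 + i + 1) * (1 / (n : ℚ_[(p : ℕ)]) ^ (m + 1 + i + 1)))) := by
  have hn1 := norm_natCast_eq_one h0 hn
  have h21 : ‖(2 : ℚ_[(p : ℕ)])‖ = 1 := by
    exact_mod_cast norm_natCast_eq_one (p := p) (n := 2) (by omega) hp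
  have hn0 : (n : ℚ_[(p : ℕ)]) ≠ 0 := by exact_mod_cast h0.ne'
  set t : ℚ_[(p : ℕ)] := (p : ℕ) / (2 * n) with ht
  have htn : ‖t‖ = ((p : ℕ) : ℝ)⁻¹ := by
    rw [ht, norm_div, norm_mul, hn1, h21, Padic.norm_p]
    simp
  have ht1 : ‖t‖ < 1 := by
    rw [htn]
    exact inv_lt_one_of_one_lt₀ (by exact_mod_cast p.2.one_lt)
  have hpt : (((p : ℕ) : ℚ_[(p : ℕ)])) = t * (2 * n) := by
    rw [ht]
    field_simp
  have h1t : 1 - t ≠ 0 := by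
    rw [← norm_ne_zero_iff, norm_one_sub_eq_one ht1]
    exact one_ne_zero
  -- Since p/n = 2t and 2n - p = 2n(1 - t), everything is (2t)^(m+1) times a truncation error; the
  -- subtracted 1/n^(m+1) is its j = 0 term, and j = i + 1 yields `doublingCoeff m i`.
  have key : ((p : ℕ) : ℚ_[(p : ℕ)]) ^ (m + 1) *
        (2 ^ (m + 1) / (2 * (n : ℚ_[(p : ℕ)]) - (p : ℕ)) ^ (m + 1) - 1 / (n : ℚ_[(p : ℕ)]) ^ (m + 1)) -
      ∑ i ∈ Finset.range J, (doublingCoeff m i : ℚ_[(p : ℕ)]) *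
        (((p : ℕ) : ℚ_[(p : ℕ)]) ^ (m + 1 + i + 1) * (1 / (n : ℚ_[(p : ℕ)]) ^ (m + 1 + i + 1))) =
      (2 * t) ^ (m + 1) * ((1 - t)⁻¹ ^ (m + 1) -
        ∑ j ∈ Finset.range (J + 1), ((m + j).choose m : ℚ_[(p : ℕ)]) * t ^ j) := by
    rw [Finset.sum_range_succ', mul_sub, mul_sub, mul_add, Finset.mul_sum, sub_add_eq_sub_sub_swap]
    congr 1
    · rw [hpt, show 2 * (n : ℚ_[(p : ℕ)]) - t * (2 * n) = 2 * n * (1 - t) by ring]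
      simp only [mul_pow, inv_pow, add_zero, Nat.choose_self, Nat.cast_one, pow_zero]
      field_simp
    · refine Finset.sum_congr rfl fun i _ => ?_
      unfold doublingCoeff
      push_cast
      rw [hpt]
      simp only [mul_pow, pow_succ, pow_add]
      field_simp
  rw [key]
  unfold ValGE
  rw [norm_mul, norm_pow, norm_mul, h21, one_mul]
  refine (mul_le_mul_of_nonneg_left (norm_inv_one_sub_pow_sub_sum_le ht1 m (J + 1))
    (by positivity)).trans ?_
  rw [htn, ← pow_add, inv_pow, zpow_neg, show ((m : ℤ) + 2 + J) = ((m + 1 + (J + 1) : ℕ) : ℤ) by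
    push_cast; ring, zpow_natCast]

/-- The truncated expansion of P_{m+1} in U_{m+2}, U_{m+3}, ...: the bound of `valGE_doubling_term`
is uniform in n, so it survives summation. -/
theorem doubling_relation (m J : ℕ) :
    ((2 : ℚ) ^ (m + 1) - 1) • powerSum m -
      ∑ i ∈ Finset.range J, doublingCoeff m i • upperSum (m + 1 + i) ∈ Fil (m + 2 + J) := by
  have h : ((2 : ℚ) ^ (m + 1) - 1) • powerSum m -
      ∑ i ∈ Finset.range J, doublingCoeff m i • upperSum (m + 1 + i) =
      QInf.mk (((2 : ℚ) ^ (m + 1) - 1) • fullFamily (m + 1) -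
        ∑ i ∈ Finset.range J, doublingCoeff m i • upperFamily (m + 1 + i + 1)) := by
    rw [map_sub, map_sum, mk_smul, powerSum_eq]
    rfl
  rw [h]
  refine mk_mem_Fil ?_
  filter_upwards [eventually_gt 2] with p hp
  obtain ⟨q, hq⟩ := p.2.odd_of_ne_two (by omega)
  have e : (((2 : ℚ) ^ (m + 1) - 1) • fullFamily (m + 1) -
        ∑ i ∈ Finset.range J, doublingCoeff m i • upperFamily (m + 1 + i + 1)).1 p =
      ∑ n ∈ Finset.Ioc q (2 * q), (((p : ℕ) : ℚ_[(p : ℕ)]) ^ (m + 1) *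
        (2 ^ (m + 1) / (2 * (n : ℚ_[(p : ℕ)]) - (p : ℕ)) ^ (m + 1) - 1 / (n : ℚ_[(p : ℕ)]) ^ (m + 1)) -
      ∑ i ∈ Finset.range J, (doublingCoeff m i : ℚ_[(p : ℕ)]) *
        (((p : ℕ) : ℚ_[(p : ℕ)]) ^ (m + 1 + i + 1) *
          (1 / (n : ℚ_[(p : ℕ)]) ^ (m + 1 + i + 1)))) := by
    have hq1 : (p : ℕ) - 1 = 2 * q := by omega
    have hpq : ((p : ℕ) : ℚ_[(p : ℕ)]) = 2 * (q : ℚ_[(p : ℕ)]) + 1 := by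
      exact_mod_cast congrArg (Nat.cast : ℕ → ℚ_[(p : ℕ)]) hq
    rw [Finset.sum_sub_distrib, ← Finset.mul_sum]
    have hd := two_pow_sub_one_mul_sum (K := ℚ_[(p : ℕ)]) (m + 1) q
    rw [← hpq] at hd
    rw [← hd, Finset.sum_comm]
    simp only [← Finset.mul_sum]
    have hfull : (fullFamily (m + 1)).1 p = ((p : ℕ) : ℚ_[(p : ℕ)]) ^ (m + 1) *
        ∑ n ∈ Finset.Icc 1 (2 * q), 1 / (n : ℚ_[(p : ℕ)]) ^ (m + 1) := by
      simp [fullFamily, signedFamily, hq1]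
    have hup : ∀ k, (upperFamily k).1 p = ((p : ℕ) : ℚ_[(p : ℕ)]) ^ k *
        ∑ n ∈ Finset.Ioc q (2 * q), 1 / (n : ℚ_[(p : ℕ)]) ^ k := by
      intro k
      simp only [upperFamily, signedFamily, hq1]
      simp
    simp only [← hup]
    rw [mul_left_comm, ← hfull]
    simp [Rat.smul_def, Finset.sum_apply]
  rw [e]
  unfold ValGE
  refine IsUltrametricDist.norm_sum_le_of_forall_le_of_nonneg
    (zpow_pos (prime_pos p) _).le fun n hn => ?_
  rw [Finset.mem_Ioc] at hn
  exact valGE_doubling_term hp m J n (by omega) (by omega)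

/-! ### Expansions in power sums -/

/-- `x` has an expansion `∑_{i ≥ 0} e_i p ^ (m + i + 1) ∑_{p / 2 < n < p} 1 / n ^ (m + i + 1)`. -/
def HasUpperExpansion (m : ℕ) (x : QInf) : Prop :=
  ∃ e : ℕ → ℚ, ∀ J : ℕ,
    x - ∑ i ∈ Finset.range J, e i • upperSum (m + i) ∈ Fil (m + 1 + J)

/-- One elimination step: `doubling_relation` starts with a nonzero multiple of the leading upper
sum, so a multiple of `powerSum m` removes that term and changes only later coefficients. -/
theorem HasUpperExpansion.exists_sub_smul {m : ℕ} {x : QInf} (h : HasUpperExpansion (m + 1) x) :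
    ∃ d : ℚ, HasUpperExpansion (m + 2) (x - d • powerSum m) := by
  obtain ⟨e, he⟩ := h
  have hc : doublingCoeff m 0 ≠ 0 := by
    unfold doublingCoeff
    have : 0 < (m + (0 + 1)).choose m := Nat.choose_pos (by omega)
    positivity
  set r := e 0 / doublingCoeff m 0 with hr
  refine ⟨r * (2 ^ (m + 1) - 1), fun i => e (i + 1) - r * doublingCoeff m (i + 1), fun J => ?_⟩
  have h1 := he (J + 1)
  have h2 := smul_mem_Fil r (doubling_relation m (J + 1))
  have h3 := sub_mem h1 (Fil_anti (le_of_eq (by push_cast; ring)) h2)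
  refine Fil_anti (le_of_eq (by push_cast; ring)) (?_ : _ ∈ Fil (((m + 1 : ℕ) : ℤ) + 1 + (J + 1 : ℕ)))
  convert h3 using 1
  rw [Finset.sum_range_succ', Finset.sum_range_succ', smul_sub, smul_add, Finset.smul_sum,
    smul_smul, smul_smul, show r * doublingCoeff m 0 = e 0 from div_mul_cancel₀ _ hc]
  simp only [sub_smul, Finset.sum_sub_distrib, smul_smul]
  have hi : ∀ i, m + 1 + (i + 1) = m + 2 + i := fun i => by ring
  simp only [hi]
  abel

theorem hasUpperExpansion_upperSum (m : ℕ) : HasUpperExpansion 1 (upperSum (m + 1)) := by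
  refine ⟨fun i => if i = m then 1 else 0, fun J => ?_⟩
  simp only [ite_smul, one_smul, zero_smul, Finset.sum_ite_eq', Finset.mem_range]
  split_ifs with h
  · rw [add_comm 1 m, sub_self]
    exact zero_mem _
  · rw [sub_zero]
    exact Fil_anti (by push_cast; omega) (upperSum_mem_Fil (m + 1))

/-- `x` has an expansion `∑_{i ≥ 0} d_i p ^ (i + 1) H_{p-1}(i + 1)`. -/
def HasPowerSumExpansion (x : QInf) : Prop :=
  ∃ d : ℕ → ℚ, ∀ J : ℕ, x - ∑ i ∈ Finset.range J, d i • powerSum i ∈ Fil (J + 1)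

theorem HasUpperExpansion.hasPowerSumExpansion {x : QInf} (h : HasUpperExpansion 1 x) :
    HasPowerSumExpansion x := by
  choose! d hd using fun (m : ℕ) (y : QInf) => HasUpperExpansion.exists_sub_smul (m := m) (x := y)
  -- The successive remainders of the elimination.
  let y : ℕ → QInf := fun n => Nat.rec x (fun m z => z - d m z • powerSum m) n
  have hy : ∀ n, HasUpperExpansion (n + 1) (y n) := by
    intro n
    induction n with
    | zero => exact h
    | succ n ih => exact hd n (y n) ih
  refine ⟨fun i => d i (y i), fun J => ?_⟩
  have hs : x - ∑ i ∈ Finset.range J, d i (y i) • powerSum i = y J := by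
    induction J with
    | zero => simp [y]
    | succ J ih =>
      rw [Finset.sum_range_succ, ← sub_sub, ih]
  rw [hs]
  obtain ⟨e, he⟩ := hy J
  -- The empty truncation already places the remainder in Fil (J + 2).
  have := he 0
  rw [Finset.sum_range_zero, sub_zero] at this
  exact Fil_anti (by push_cast; omega) this

theorem hasPowerSumExpansion_powerSum (m : ℕ) : HasPowerSumExpansion (powerSum m) := by
  refine ⟨fun i => if i = m then 1 else 0, fun J => ?_⟩
  simp only [ite_smul, one_smul, zero_smul, Finset.sum_ite_eq', Finset.mem_range]
  split_ifs with h
  · rw [sub_self]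
    exact zero_mem _
  · rw [sub_zero]
    exact Fil_anti (by omega) (powerSum_mem_Fil m)

theorem HasPowerSumExpansion.smul_add_smul {x y : QInf} (hx : HasPowerSumExpansion x)
    (hy : HasPowerSumExpansion y) (a b : ℚ) : HasPowerSumExpansion (a • x + b • y) := by
  obtain ⟨d, hd⟩ := hx
  obtain ⟨e, he⟩ := hy
  refine ⟨fun i => a * d i + b * e i, fun J => ?_⟩
  convert add_mem (smul_mem_Fil a (hd J)) (smul_mem_Fil b (he J)) using 1
  simp only [add_smul, Finset.sum_add_distrib, smul_sub, Finset.smul_sum, smul_smul]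
  abel

theorem HasPowerSumExpansion.mem_weightedMHSAlgebra {x : QInf} (hx : HasPowerSumExpansion x) :
    x ∈ weightedMHSAlgebra := by
  obtain ⟨d, hd⟩ := hx
  have h : IsMHSExpansion d (fun i => ((i + 1 : ℕ) : ℤ)) (fun i => [i.succPNat]) x :=
    ⟨tendsto_natCast_atTop_atTop.comp (tendsto_add_atTop_nat 1),
      hasSum_of_forall_mem_Fil (fun i => smul_mem_Fil (d i) (powerSum_mem_Fil i)) hd⟩
  exact ⟨⟨_, _, _, h⟩, _, _, _, h, fun i => by simp [weight]⟩

/-! ### Reduction of the two sums to full and upper power sums -/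

theorem inWeightedMHSAlgebra_of_eventually_eq {a : Nat.Primes → ℚ} (m : ℕ) (α β : ℚ)
    (ha : (fun p : Nat.Primes => (a p : ℚ_[(p : ℕ)])) ∈ boundedBelow)
    (h : ∀ᶠ p : Nat.Primes in cofinite, a p = ((p : ℕ) : ℚ) ^ (m + 2) *
      (α * ∑ n ∈ Finset.Icc 1 ((p : ℕ) - 1), 1 / (n : ℚ) ^ (m + 2) +
        β * ∑ n ∈ Finset.Ioc (((p : ℕ) - 1) / 2) ((p : ℕ) - 1), 1 / (n : ℚ) ^ (m + 2))) :
    InWeightedMHSAlgebra a := by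
  refine ⟨ha, ?_⟩
  have hx := (hasPowerSumExpansion_powerSum (m + 1)).smul_add_smul
    (hasUpperExpansion_upperSum m).hasPowerSumExpansion α β
  convert hx.mem_weightedMHSAlgebra using 1
  rw [powerSum_eq, upperSum, ← mk_smul, ← mk_smul, ← map_add]
  refine mk_eq_mk ?_
  filter_upwards [h] with p hp
  change (a p : ℚ_[(p : ℕ)]) = α • (((_ : ℚ)) : ℚ_[(p : ℕ)]) + β • (((_ : ℚ)) : ℚ_[(p : ℕ)])
  rw [hp, Rat.smul_def, Rat.smul_def, ← Rat.cast_mul, ← Rat.cast_mul, ← Rat.cast_add, Rat.cast_inj]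
  simp only [Pi.one_apply, Int.cast_one]
  ring

/-- Adding the unsigned sum kills the odd terms and doubles the even ones, where n = 2n' brings out
(1/2)^k. -/
theorem sum_Icc_neg_one_pow_div (k q : ℕ) :
    ∑ n ∈ Finset.Icc 1 (2 * q), (-1 : ℚ) ^ n / (n : ℚ) ^ k =
      2 * (1 / 2) ^ k * ∑ n ∈ Finset.Icc 1 q, 1 / (n : ℚ) ^ k -
        ∑ n ∈ Finset.Icc 1 (2 * q), 1 / (n : ℚ) ^ k := by
  induction q with
  | zero => simp
  | succ q ih =>
    rw [show 2 * (q + 1) = 2 * q + 1 + 1 by ring]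
    simp only [Finset.sum_Icc_succ_top (show 1 ≤ 2 * q + 1 + 1 by omega),
      Finset.sum_Icc_succ_top (show 1 ≤ 2 * q + 1 by omega),
      Finset.sum_Icc_succ_top (show 1 ≤ q + 1 by omega)]
    rw [ih]
    have h1 : (-1 : ℚ) ^ (2 * q + 1) = -1 := Odd.neg_one_pow ⟨q, rfl⟩
    have h2 : (-1 : ℚ) ^ (2 * q + 1 + 1) = 1 := Even.neg_one_pow ⟨q + 1, by ring⟩
    have h3 : 1 / ((2 * q + 1 + 1 : ℕ) : ℚ) ^ k = (1 / 2) ^ k * (1 / ((q + 1 : ℕ) : ℚ) ^ k) := by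
      rw [show 2 * q + 1 + 1 = 2 * (q + 1) by ring, Nat.cast_mul, mul_pow]
      simp [mul_comm]
    rw [h1, h2, h3]
    ring

end MHS

theorem mainTheorem4 (k : ℕ) (hk : 2 ≤ k) :
    MHS.InWeightedMHSAlgebra (fun p : Nat.Primes =>
        ((p : ℕ) : ℚ) ^ k * ∑ n ∈ Finset.Icc 1 (((p : ℕ) - 1) / 2), 1 / (n : ℚ) ^ k) ∧
      MHS.InWeightedMHSAlgebra (fun p : Nat.Primes =>
        ((p : ℕ) : ℚ) ^ k * ∑ n ∈ Finset.Icc 1 ((p : ℕ) - 1), (-1 : ℚ) ^ n / (n : ℚ) ^ k) := by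
  obtain ⟨m, rfl⟩ := Nat.exists_eq_add_of_le' hk
  constructor
  -- The lower half is the full sum minus the upper half.
  · refine MHS.inWeightedMHSAlgebra_of_eventually_eq m 1 (-1) ?_ (Eventually.of_forall fun p => ?_)
    · refine ⟨(m + 2 : ℕ), fun p => ?_⟩
      simpa using MHS.valGE_pow_mul_sum p (m + 2) _ 1 (MHS.half_bounds p)
    · rw [MHS.sum_Icc_one_eq_add_sum_Ioc _ (Nat.div_le_self ((p : ℕ) - 1) 2)]
      ring
  · refine MHS.inWeightedMHSAlgebra_of_eventually_eq m (2 * (1 / 2) ^ (m + 2) - 1)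
      (-(2 * (1 / 2) ^ (m + 2))) ?_ ?_
    · refine ⟨(m + 2 : ℕ), fun p => ?_⟩
      simpa using MHS.valGE_pow_mul_sum p (m + 2) _ (fun n => (-1) ^ n) (MHS.full_bounds p)
    · filter_upwards [MHS.eventually_gt 2] with p hp
      obtain ⟨q, hq⟩ := p.2.odd_of_ne_two (by omega)
      rw [show (p : ℕ) - 1 = 2 * q by omega, show 2 * q / 2 = q by omega,
        MHS.sum_Icc_neg_one_pow_div,
        MHS.sum_Icc_one_eq_add_sum_Ioc (fun n => 1 / (n : ℚ) ^ (m + 2)) (show q ≤ 2 * q by omega)]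
      ring
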